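/- Let $v$ and $k$ be positive integers with $k\equiv 7,12,17$ or $22 \pmod{25}$ and $v=k(k-1)-1$. Then there is no symmetric $(v,k,1)$-covering whose excess is a vertex-disjoint union of cycles each of length $2$ or $3$ (that is, whose excess consists only of $2$-cycles and $3$-cycles). Here a $(v,k,\lambda)$-covering is a pair $(V,\mathcal B)$, where $V$ is a set of $v$ points and $\mathcal B$ is a finite collection of $k$-element subsets of $V$ (blocks, possibly repeated) such that any two distinct points $x,y$ lie together in $r_{xy}\ge\lambda$ blocks. It is symmetric if the number of blocks (counted with repetition) is $v$. Its excess is the loopless multigraph with vertex set $V$ in which distinct vertices $x,y$ are joined by exactly $r_{xy}-\lambda$ edges. A $2$-cycle is a pair of parallel edges, and a union of cycles is understood to contain every vertex and every edge of the excess. -/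

import Mathlib

namespace PairCovering

/-- A loopless multigraph on the vertex set `V`, given by its edge multiplicities:
`mult x y` is the number of edges joining `x` and `y`. -/
structure Multigraph (V : Type*) where
  mult : V → V → ℕ
  symm : ∀ x y, mult x y = mult y x
  loopless : ∀ x, mult x x = 0

section

variable {V ι : Type*} [Fintype V] [DecidableEq V] [Fintype ι]

/-- The number `r_{xy}` of blocks of the family `B` that contain both `x` and `y`.
The collection of blocks is an indexed family, so repeated blocks are allowed and
are counted with repetition. -/
def pairCount (B : ι → Finset V) (x y : V) : ℕ :=
  (Finset.univ.filter fun i => x ∈ B i ∧ y ∈ B i).card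

/-- The family `B` of subsets of `V` is the collection of blocks of a
`(v, k, lam)`-covering with point set `V`. -/
structure IsCovering (B : ι → Finset V) (v k lam : ℕ) : Prop where
  card_points : Fintype.card V = v
  card_block : ∀ i, (B i).card = k
  covers : ∀ x y, x ≠ y → lam ≤ pairCount B x y

/-- A covering is symmetric if it has the same number of blocks as points. -/
structure IsSymmetricCovering (B : ι → Finset V) (v k lam : ℕ) : Prop
    extends IsCovering B v k lam where
  card_blocks : Fintype.card ι = Fintype.card V

/-- The excess multigraph: distinct points `x`, `y` are joined by `r_{xy} - lam` edges.
In a covering `lam ≤ r_{xy}`, so the subtraction of natural numbers is exact. -/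
def excess (B : ι → Finset V) (lam : ℕ) : Multigraph V where
  mult x y := if x = y then 0 else pairCount B x y - lam
  symm x y := by simp only [pairCount, and_comm, eq_comm]
  loopless x := by simp

/-- The multigraph `G` has cycle type `[c 0, …, c (t - 1)]`: it is the vertex-disjoint union
of `t` cycles of these lengths (each at least 2), which together use all vertices and all edges.
The vertices of the `i`-th cycle, in cyclic order, are `w i 0, …, w i (c i - 1)`, and its `c i`
edges join `w i j` to `w i (j + 1)`, with `j + 1` taken modulo `c i` (`finRotate` is the map
`j ↦ j + 1`). In particular a cycle of length 2 is a pair of parallel edges. -/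
def Multigraph.HasCycleType (G : Multigraph V) {t : ℕ} (c : Fin t → ℕ) : Prop :=
  (∀ i, 2 ≤ c i) ∧
  ∃ w : (i : Fin t) → Fin (c i) → V,
    Function.Bijective (fun p : (i : Fin t) × Fin (c i) => w p.1 p.2) ∧
    ∀ x y : V, G.mult x y =
      (Finset.univ.filter fun p : (i : Fin t) × Fin (c i) =>
        s(w p.1 p.2, w p.1 (finRotate (c p.1) p.2)) = s(x, y)).card

end

end PairCovering

/-! ### Discriminants and isotropic subspaces -/

open Matrix

/-! Let `N` be the incidence matrix and `A` the adjacency matrix of the excess. Then `N Nᵀ = (k - 1)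
I + A + J`. Let `T` be the space of vectors supported on the 3-cycles with sum zero on each; `N Nᵀ`
acts on `T` as `k - 2`, which is divisible by 5 exactly once. Modulo 5, `T` is the whole kernel of
`N Nᵀ`, so, `N` being square, the kernel of `Nᵀ` fills at least half of `T`. Lifting to the integers
shows that this kernel is totally isotropic for the dot product. With `n` triangles the form on `T`
has dimension `2n` and discriminant `12 ^ n`, which must then be `(-1) ^ n` times a square; as 2 is
not a square modulo 5 and -1 is, `n` is even (`even_card_triangles`). But `n` has the parity of `v =
k (k - 1) - 1`, which is odd. -/

theorem det_fromBlocks_zero_transpose {β R : Type*} [Fintype β] [DecidableEq β] [CommRing R]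
    (H D : Matrix β β R) :
    (fromBlocks 0 H Hᵀ D).det = (-1) ^ Fintype.card β * H.det ^ 2 := by
  -- Multiplying by the symplectic `J` swaps the block columns up to sign at no cost in determinant.
  have hJ : (Matrix.J β R).det = 1 := SymplecticGroup.det_eq_one (SymplecticGroup.J_mem β R)
  have h : fromBlocks 0 H Hᵀ D * Matrix.J β R = fromBlocks H 0 D (-Hᵀ) := by
    simp [Matrix.J, fromBlocks_multiply]
  have h2 := congrArg det h
  rw [det_mul, hJ, mul_one, det_fromBlocks_zero₁₂, det_neg, det_transpose] at h2
  rw [h2]; ring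

/-- A subspace of dimension at least half of the ambient space extends from a linearly
independent family to a basis indexed by two copies of `β`. -/
theorem exists_basis_sum_mem {β F V : Type*} [Fintype β] [DecidableEq β] [Field F]
    [AddCommGroup V] [Module F V] [FiniteDimensional F V]
    (hV : Module.finrank F V = Fintype.card β + Fintype.card β)
    (K : Submodule F V) (hK : Fintype.card β ≤ Module.finrank F K) :
    ∃ b : Module.Basis (β ⊕ β) F V, ∀ i, b (Sum.inl i) ∈ K := by
  obtain ⟨f, hf⟩ := exists_linearIndependent_of_le_finrank hK
  have hf' : LinearIndependent F (fun i => (f i : V)) :=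
    hf.map' K.subtype (Submodule.ker_subtype K)
  have hg : LinearIndependent F (fun i : β => (f (Fintype.equivFin β i) : V)) :=
    hf'.comp _ (Fintype.equivFin β).injective
  set U := Submodule.span F (Set.range fun i : β => (f (Fintype.equivFin β i) : V)) with hU
  obtain ⟨W, hW⟩ := Submodule.exists_isCompl U
  have h1 : Module.finrank F U = Fintype.card β := finrank_span_eq_card hg
  have h2 := Submodule.finrank_add_eq_of_isCompl hW
  have h3 : Module.finrank F W = Fintype.card β := by omega
  let bU : Module.Basis β F U := Module.Basis.span hg
  let bW : Module.Basis β F W :=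
    (Module.finBasisOfFinrankEq F W h3).reindex (Fintype.equivFin β).symm
  refine ⟨(bU.prod bW).map (Submodule.prodEquivOfIsCompl U W hW), fun i => ?_⟩
  have : ((bU i : U) : V) = f (Fintype.equivFin β i) :=
    congrArg Subtype.val (Module.Basis.span_apply hg i)
  simp [this]

/-- A symmetric form on a space of dimension `2 n` with a totally isotropic subspace of dimension
at least `n` has determinant `(-1) ^ n` up to squares. -/
theorem exists_det_eq_of_isotropic {β F : Type*} [Fintype β] [DecidableEq β] [Field F]
    (G : Matrix (β ⊕ β) (β ⊕ β) F) (hG : G.IsSymm) (K : Submodule F (β ⊕ β → F))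
    (hK : Fintype.card β ≤ Module.finrank F K)
    (hiso : ∀ x ∈ K, ∀ y ∈ K, x ⬝ᵥ (G *ᵥ y) = 0) :
    ∃ s : F, G.det = (-1) ^ Fintype.card β * s ^ 2 := by
  obtain ⟨b, hb⟩ := exists_basis_sum_mem (by simp) K hK
  let Q : Matrix (β ⊕ β) (β ⊕ β) F := Matrix.of fun i => b i
  have hQ : Q.det ≠ 0 := by
    have : IsUnit Q := linearIndependent_rows_iff_isUnit.1 b.linearIndependent
    exact ((isUnit_iff_isUnit_det Q).1 this).ne_zero
  have hT : (Q * G * Qᵀ)ᵀ = Q * G * Qᵀ := by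
    simp [transpose_mul, hG.eq, Matrix.mul_assoc]
  have h11 : (Q * G * Qᵀ).toBlocks₁₁ = 0 := by
    ext i j
    have := hiso _ (hb i) _ (hb j)
    rw [dotProduct_mulVec] at this
    exact this
  have h21 : (Q * G * Qᵀ).toBlocks₂₁ = (Q * G * Qᵀ).toBlocks₁₂ᵀ := by
    ext i j
    exact (congrFun (congrFun hT (Sum.inr i)) (Sum.inl j)).symm
  have h := det_fromBlocks_zero_transpose (Q * G * Qᵀ).toBlocks₁₂ (Q * G * Qᵀ).toBlocks₂₂
  rw [← h21, ← h11, fromBlocks_toBlocks, det_mul, det_mul, det_transpose] at h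
  refine ⟨(Q * G * Qᵀ).toBlocks₁₂.det / Q.det, ?_⟩
  rw [div_pow, ← mul_div_assoc, ← h]
  field_simp

theorem ZMod.two_ne_neg_sq : ∀ r : ZMod 5, 2 ≠ -r ^ 2 := by decide

theorem ZMod.six_eq_one : (6 : ZMod 5) = 1 := rfl

theorem ZMod.two_ne_zero_five : (2 : ZMod 5) ≠ 0 := by decide

/-- The form is diagonal with determinant `2 ^ n * 6 ^ n = 2 ^ n` modulo 5. For odd `n` this would
make 2 the negative of a square. -/
theorem even_card_of_isotropic {β : Type*} [Fintype β] [DecidableEq β]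
    (K : Submodule (ZMod 5) (β ⊕ β → ZMod 5))
    (hK : Fintype.card β ≤ Module.finrank (ZMod 5) K)
    (hiso : ∀ x ∈ K, ∀ y ∈ K,
      ∑ i, (2 * x (.inl i) * y (.inl i) + 6 * x (.inr i) * y (.inr i)) = 0) :
    Even (Fintype.card β) := by
  have : Fact (Nat.Prime 5) := ⟨by norm_num⟩
  obtain ⟨s, hs⟩ := exists_det_eq_of_isotropic
    (diagonal (Sum.elim (fun _ => 2) (fun _ => 6)) : Matrix (β ⊕ β) (β ⊕ β) (ZMod 5))
    (isSymm_diagonal _) K hK (fun x hx y hy => by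
      rw [← hiso x hx y hy, Finset.sum_add_distrib]
      simp only [dotProduct, mulVec_diagonal, Fintype.sum_sum_type, Sum.elim_inl, Sum.elim_inr]
      congr 1 <;> exact Finset.sum_congr rfl fun i _ => by ring)
  by_contra hodd
  obtain ⟨m, hm⟩ := Nat.not_even_iff_odd.1 hodd
  simp only [det_diagonal, Fintype.prod_sum_type, Sum.elim_inl, Sum.elim_inr,
    Finset.prod_const, Finset.card_univ, hm] at hs
  rw [ZMod.six_eq_one, one_pow, mul_one, pow_succ, pow_mul', pow_succ (-1),
    pow_mul (-1)] at hs
  have h2 : ((2 : ZMod 5) ^ m) ≠ 0 := pow_ne_zero _ ZMod.two_ne_zero_five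
  have : (2 : ZMod 5) = - (s / 2 ^ m) ^ 2 := by
    field_simp
    linear_combination hs
  exact ZMod.two_ne_neg_sq _ this

/-! ### Cycles and triangle vectors -/

theorem add_finRotate_add_symm {n : ℕ} (hn : n = 3) {R : Type*} [CommRing R] (g : Fin n → R)
    (j : Fin n) : g j + g (finRotate n j) + g ((finRotate n).symm j) = ∑ i, g i := by
  subst hn
  rw [Fin.sum_univ_three]
  have h0 : (finRotate 3).symm 0 = 2 := by decide
  have h1 : (finRotate 3).symm 1 = 0 := by decide
  have h2 : (finRotate 3).symm 2 = 1 := by decide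
  have h3 : finRotate 3 0 = 1 := by decide
  have h4 : finRotate 3 1 = 2 := by decide
  have h5 : finRotate 3 2 = 0 := by decide
  fin_cases j
  · simp [h0, h3]
  · simp [h1, h4]; ring
  · simp [h2, h5]; ring

theorem finRotate_add_symm {n : ℕ} (hn : n = 2) {R : Type*} [CommRing R] (g : Fin n → R)
    (j : Fin n) : g (finRotate n j) + g ((finRotate n).symm j) = 2 * (∑ i, g i - g j) := by
  subst hn
  rw [Fin.sum_univ_two]
  have h0 : (finRotate 2).symm 0 = 1 := by decide
  have h1 : (finRotate 2).symm 1 = 0 := by decide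
  have h3 : finRotate 2 0 = 1 := by decide
  have h4 : finRotate 2 1 = 0 := by decide
  fin_cases j
  · simp [h0, h3]; ring
  · simp [h1, h4]; ring

theorem finRotate_ne_self {n : ℕ} (hn : 2 ≤ n) (j : Fin n) : finRotate n j ≠ j := by
  obtain ⟨m, rfl⟩ : ∃ m, n = m + 2 := ⟨n - 2, by omega⟩
  rw [finRotate_apply]
  simp

theorem Fin.sum_val_of_eq_three {n : ℕ} (hn : n = 3) {R : Type*} [CommRing R] (f : ℕ → R) :
    ∑ j : Fin n, f j = f 0 + f 1 + f 2 := by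
  subst hn
  simp [Fin.sum_univ_three]

section

variable {τ : Type*} (c : τ → ℕ)

/-- The cyclic successor on a disjoint union of cycles of lengths `c i`. -/
def cycleSucc : Equiv.Perm ((i : τ) × Fin (c i)) :=
  Equiv.sigmaCongrRight fun i => finRotate (c i)

/-- The vectors that vanish outside the cycles of length 3 and have sum zero on each of these,
in terms of coordinates with respect to `(1, -1, 0)` and `(1, 1, -2)`. -/
def triangleVec (R : Type*) [CommRing R] :
    ({i // c i = 3} ⊕ {i // c i = 3} → R) →ₗ[R] ((i : τ) × Fin (c i) → R) where
  toFun x p := if h : c p.1 = 3 then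
      (if (p.2 : ℕ) = 0 then x (.inl ⟨p.1, h⟩) + x (.inr ⟨p.1, h⟩)
      else if (p.2 : ℕ) = 1 then -x (.inl ⟨p.1, h⟩) + x (.inr ⟨p.1, h⟩)
      else -2 * x (.inr ⟨p.1, h⟩))
    else 0
  map_add' x y := by
    ext p
    simp only [Pi.add_apply]
    split_ifs <;> ring
  map_smul' r x := by
    ext p
    simp only [Pi.smul_apply, smul_eq_mul, RingHom.id_apply]
    split_ifs <;> ring

variable {c} {R : Type*} [CommRing R]

theorem triangleVec_of_ne {p : (i : τ) × Fin (c i)} (h : c p.1 ≠ 3)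
    (x : {i // c i = 3} ⊕ {i // c i = 3} → R) : triangleVec c R x p = 0 := dif_neg h

theorem triangleVec_of_eq {i : τ} (h : c i = 3) (j : Fin (c i))
    (x : {i // c i = 3} ⊕ {i // c i = 3} → R) :
    triangleVec c R x ⟨i, j⟩ =
      if (j : ℕ) = 0 then x (.inl ⟨i, h⟩) + x (.inr ⟨i, h⟩)
      else if (j : ℕ) = 1 then -x (.inl ⟨i, h⟩) + x (.inr ⟨i, h⟩)
      else -2 * x (.inr ⟨i, h⟩) := dif_pos h

theorem sum_triangleVec_cycle (x : {i // c i = 3} ⊕ {i // c i = 3} → R) (i : τ) :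
    ∑ j, triangleVec c R x ⟨i, j⟩ = 0 := by
  by_cases h : c i = 3
  · simp only [triangleVec_of_eq h]
    rw [Fin.sum_val_of_eq_three h fun n => if n = 0 then x (.inl ⟨i, h⟩) + x (.inr ⟨i, h⟩)
      else if n = 1 then -x (.inl ⟨i, h⟩) + x (.inr ⟨i, h⟩) else -2 * x (.inr ⟨i, h⟩)]
    simp
    ring
  · exact Finset.sum_eq_zero fun j _ => triangleVec_of_ne h x

theorem triangleVec_map {S : Type*} [CommRing S] (f : R →+* S)
    (x : {i // c i = 3} ⊕ {i // c i = 3} → R) :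
    triangleVec c S (f ∘ x) = f ∘ triangleVec c R x := by
  ext ⟨i, j⟩
  by_cases h : c i = 3
  · simp only [Function.comp_apply, triangleVec_of_eq h]
    split_ifs <;> simp [map_ofNat]
  · simp [triangleVec_of_ne (p := ⟨i, j⟩) h]

variable [Fintype τ]

theorem sum_triangleVec (x : {i // c i = 3} ⊕ {i // c i = 3} → R) :
    ∑ p, triangleVec c R x p = 0 := by
  rw [Fintype.sum_sigma]
  exact Finset.sum_eq_zero fun i _ => sum_triangleVec_cycle x i

theorem triangleVec_dotProduct (x y : {i // c i = 3} ⊕ {i // c i = 3} → R) :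
    triangleVec c R x ⬝ᵥ triangleVec c R y =
      ∑ i, (2 * x (.inl i) * y (.inl i) + 6 * x (.inr i) * y (.inr i)) := by
  rw [dotProduct, Fintype.sum_sigma, ← Fintype.sum_subtype_add_sum_subtype (fun i => c i = 3)]
  have h2 : ∑ i : {i // ¬ c i = 3}, ∑ j, triangleVec c R x ⟨i, j⟩ * triangleVec c R y ⟨i, j⟩ = 0 :=
    Finset.sum_eq_zero fun i _ => Finset.sum_eq_zero fun j _ => by
      rw [triangleVec_of_ne i.2, zero_mul]
  rw [h2, add_zero]
  refine Finset.sum_congr rfl fun i _ => ?_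
  obtain ⟨i, h⟩ := i
  simp only [triangleVec_of_eq h]
  rw [Fin.sum_val_of_eq_three h fun n => (if n = 0 then x (.inl ⟨i, h⟩) + x (.inr ⟨i, h⟩)
      else if n = 1 then -x (.inl ⟨i, h⟩) + x (.inr ⟨i, h⟩) else -2 * x (.inr ⟨i, h⟩)) *
      (if n = 0 then y (.inl ⟨i, h⟩) + y (.inr ⟨i, h⟩)
      else if n = 1 then -y (.inl ⟨i, h⟩) + y (.inr ⟨i, h⟩) else -2 * y (.inr ⟨i, h⟩))]
  simp
  ring

variable [DecidableEq τ]

variable (c) in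
/-- The matrix `κ I + A + J`, where `A` is the adjacency matrix of a disjoint union of cycles of
lengths `c i`. -/
def cycleGram (κ : R) : Matrix ((i : τ) × Fin (c i)) ((i : τ) × Fin (c i)) R :=
  Matrix.of fun p q => (if q = p then κ else 0) + (if q = cycleSucc c p then 1 else 0) +
    (if q = (cycleSucc c).symm p then 1 else 0) + 1

theorem cycleGram_mulVec (κ : R) (f : (i : τ) × Fin (c i) → R) (p : (i : τ) × Fin (c i)) :
    (cycleGram c κ *ᵥ f) p =
      κ * f p + f (cycleSucc c p) + f ((cycleSucc c).symm p) + ∑ q, f q := by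
  simp [cycleGram, mulVec, dotProduct, add_mul, Finset.sum_add_distrib]

/-- `J` kills vectors of sum zero, and on a triangle `A` sends such a vector to its negative. -/
theorem cycleGram_mulVec_triangleVec (κ : R) (x : {i // c i = 3} ⊕ {i // c i = 3} → R) :
    cycleGram c κ *ᵥ triangleVec c R x = (κ - 1) • triangleVec c R x := by
  ext ⟨i, j⟩
  rw [cycleGram_mulVec, sum_triangleVec, Pi.smul_apply, smul_eq_mul]
  change _ + triangleVec c R x ⟨i, finRotate _ j⟩ +
    triangleVec c R x ⟨i, (finRotate _).symm j⟩ + 0 = _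
  by_cases h : c i = 3
  · have := add_finRotate_add_symm h (fun j => triangleVec c R x ⟨i, j⟩) j
    rw [sum_triangleVec_cycle] at this
    linear_combination this
  · simp [triangleVec_of_ne (p := ⟨i, _⟩) h]

theorem sum_cycleGram_mulVec (κ : R) (f : (i : τ) × Fin (c i) → R) :
    ∑ p, (cycleGram c κ *ᵥ f) p =
      (κ + 2 + (Fintype.card ((i : τ) × Fin (c i)) : R)) * ∑ p, f p := by
  simp only [cycleGram_mulVec, Finset.sum_add_distrib, ← Finset.mul_sum, Equiv.sum_comp,
    Finset.sum_const, Finset.card_univ, nsmul_eq_mul]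
  ring

/-- Summing all coordinates gives `4 ∑ f = 0`, so `J` drops out. On a 2-cycle `I + A` has
eigenvalues 3 and -1, both nonzero modulo 5; on a triangle it leaves just the condition of sum zero.
-/
theorem exists_eq_triangleVec (hc : ∀ i, c i = 2 ∨ c i = 3)
    (hcard : (Fintype.card ((i : τ) × Fin (c i)) : ZMod 5) = 1)
    (f : (i : τ) × Fin (c i) → ZMod 5) (hf : cycleGram c 1 *ᵥ f = 0) :
    ∃ x, triangleVec c (ZMod 5) x = f := by
  have h5 : (5 : ZMod 5) = 0 := rfl
  have hS : ∑ p, f p = 0 := by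
    have := sum_cycleGram_mulVec 1 f
    simp only [hf, hcard, Pi.zero_apply, Finset.sum_const_zero] at this
    linear_combination this + (∑ p, f p) * h5
  have key (i : τ) (j : Fin (c i)) :
      f ⟨i, j⟩ + f ⟨i, finRotate _ j⟩ + f ⟨i, (finRotate _).symm j⟩ = 0 := by
    have := cycleGram_mulVec 1 f ⟨i, j⟩
    rw [hf, hS, one_mul, add_zero] at this
    exact this.symm
  let z (i : {i // c i = 3}) (n : ℕ) (hn : n < 3) : ZMod 5 := f ⟨i, n, hn.trans_eq i.2.symm⟩
  -- The factor 3 is the inverse of 2 modulo 5.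
  refine ⟨Sum.elim (fun i => 3 * (z i 0 (by norm_num) - z i 1 (by norm_num)))
    (fun i => 3 * (z i 0 (by norm_num) + z i 1 (by norm_num))), ?_⟩
  ext ⟨i, j⟩
  rcases hc i with h | h
  · rw [triangleVec_of_ne (by simp [h])]
    have h1 (j : Fin (c i)) : f ⟨i, j⟩ = 2 * ∑ j, f ⟨i, j⟩ := by
      have := finRotate_add_symm h (fun j => f ⟨i, j⟩) j
      linear_combination this - key i j
    have h2 : ∑ j, f ⟨i, j⟩ = c i * (2 * ∑ j, f ⟨i, j⟩) := by
      conv_lhs => rw [Finset.sum_congr rfl fun j _ => h1 j]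
      simp
    have hci : (c i : ZMod 5) = 2 := by rw [h]; rfl
    rw [hci] at h2
    rw [h1 j]
    linear_combination 4 * h2 + 2 * h5 * ∑ j, f ⟨i, j⟩
  · have hz : z ⟨i, h⟩ 0 (by norm_num) + z ⟨i, h⟩ 1 (by norm_num) +
        z ⟨i, h⟩ 2 (by norm_num) = 0 := by
      have h3 := add_finRotate_add_symm h (fun j => f ⟨i, j⟩) j
      rw [key i j, ← Fin.sum_congr' _ h.symm, Fin.sum_univ_three] at h3
      exact h3.symm
    rw [triangleVec_of_eq h]
    obtain ⟨j, hj⟩ := j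
    have hj3 : j < 3 := h ▸ hj
    change _ = z ⟨i, h⟩ j hj3
    simp only [Sum.elim_inl, Sum.elim_inr]
    interval_cases j
    · simp only [if_true]
      linear_combination z ⟨i, h⟩ 0 (by norm_num) * h5
    · simp only [one_ne_zero, if_false, if_true]
      linear_combination z ⟨i, h⟩ 1 (by norm_num) * h5
    · simp only [OfNat.ofNat_ne_zero, OfNat.ofNat_ne_one, if_false]
      linear_combination (-1 : ZMod 5) * hz -
        (z ⟨i, h⟩ 0 (by norm_num) + z ⟨i, h⟩ 1 (by norm_num)) * h5

/-- If `(κ I + A + J)` factors as `N Nᵀ` over the integers, then the number of cycles of length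
3 is even. -/
theorem even_card_triangles {ι : Type*} [Fintype ι] (hc : ∀ i, c i = 2 ∨ c i = 3)
    (hcard : (Fintype.card ((i : τ) × Fin (c i)) : ZMod 5) = 1)
    (hι : Fintype.card ι = Fintype.card ((i : τ) × Fin (c i)))
    (κ : ℤ) (h5 : 5 ∣ κ - 1) (h25 : ¬ 25 ∣ κ - 1)
    (N : Matrix ((i : τ) × Fin (c i)) ι ℤ) (hN : N * Nᵀ = cycleGram c κ) :
    Even (Fintype.card {i // c i = 3}) := by
  have : Fact (Nat.Prime 5) := ⟨by norm_num⟩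
  let π := Int.castRingHom (ZMod 5)
  let A : Matrix ((i : τ) × Fin (c i)) ι (ZMod 5) := N.map π
  have hκ : π κ = 1 := by
    have := (ZMod.intCast_zmod_eq_zero_iff_dvd (κ - 1) 5).2 h5
    push_cast at this
    exact sub_eq_zero.1 this
  have hA : A * Aᵀ = cycleGram c 1 := by
    have : A * Aᵀ = (N * Nᵀ).map π := by
      rw [Matrix.map_mul, transpose_map]
    rw [this, hN, ← hκ]
    ext p q
    simp only [cycleGram, map_apply, of_apply, map_add, map_one, apply_ite π, map_zero]
  let φ := triangleVec c (ZMod 5)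
  let g := Aᵀ.mulVecLin ∘ₗ φ
  refine even_card_of_isotropic (LinearMap.ker g) ?_ ?_
  -- Half dimension: `Nᵀ` maps `T` into `ker N`, whose dimension is that of `ker Nᵀ` because `N` is
  -- square, and `ker Nᵀ` lies in `T`.
  · have h1 : LinearMap.range g ≤ LinearMap.ker A.mulVecLin := by
      rintro _ ⟨x, rfl⟩
      change A *ᵥ (Aᵀ *ᵥ φ x) = 0
      rw [mulVec_mulVec, hA, cycleGram_mulVec_triangleVec, sub_self, zero_smul]
    have h2 : LinearMap.ker Aᵀ.mulVecLin ≤ (LinearMap.ker g).map φ := by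
      intro f hf
      have hf' : Aᵀ *ᵥ f = 0 := hf
      obtain ⟨x, rfl⟩ := exists_eq_triangleVec hc hcard f
        (by rw [← hA, ← mulVec_mulVec, hf', mulVec_zero])
      exact ⟨x, hf, rfl⟩
    have h3 := Submodule.finrank_mono h1
    have h4 := (Submodule.finrank_mono h2).trans (Submodule.finrank_map_le φ _)
    have h5 := LinearMap.finrank_range_add_finrank_ker g
    have h6 := LinearMap.finrank_range_add_finrank_ker A.mulVecLin
    have h7 := LinearMap.finrank_range_add_finrank_ker Aᵀ.mulVecLin
    have h8 : Module.finrank _ (LinearMap.range Aᵀ.mulVecLin) =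
      Module.finrank _ (LinearMap.range A.mulVecLin) := A.rank_transpose
    simp only [Module.finrank_fintype_fun_eq_card, Fintype.card_sum] at h5 h6 h7
    omega
  · have lift (x) (hx : x ∈ LinearMap.ker g) : ∃ (X : _ → ℤ) (Z : ι → ℤ),
        x = π ∘ X ∧ Nᵀ *ᵥ triangleVec c ℤ X = (5 : ℤ) • Z := by
      choose X hX using fun i => ZMod.intCast_surjective (x i)
      have hxX : x = π ∘ X := funext fun i => (hX i).symm
      have h0 (i : ι) : (5 : ℤ) ∣ (Nᵀ *ᵥ triangleVec c ℤ X) i := by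
        refine (ZMod.intCast_zmod_eq_zero_iff_dvd _ 5).1 ?_
        have : (Aᵀ *ᵥ φ x) i = 0 := congrFun hx i
        rw [hxX] at this
        change ((Nᵀ.map π) *ᵥ triangleVec c (ZMod 5) (π ∘ X)) i = 0 at this
        rw [triangleVec_map, ← RingHom.map_mulVec] at this
        exact this
      choose Z hZ using h0
      exact ⟨X, Z, hxX, funext fun i => by simp [hZ i]⟩
    intro x hx y hy
    obtain ⟨X, Z, rfl, hZ⟩ := lift x hx
    obtain ⟨Y, W, rfl, hW⟩ := lift y hy
    -- Evaluates `Xᵀ N Nᵀ Y` in two ways; as 25 does not divide `κ - 1`, a factor 5 is left for the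
    -- dot product.
    have h : (κ - 1) * (triangleVec c ℤ X ⬝ᵥ triangleVec c ℤ Y) = 25 * (Z ⬝ᵥ W) := by
      have h1 : triangleVec c ℤ X ⬝ᵥ (N * Nᵀ) *ᵥ triangleVec c ℤ Y =
          ((5 : ℤ) • Z) ⬝ᵥ ((5 : ℤ) • W) := by
        rw [← mulVec_mulVec, dotProduct_mulVec, ← mulVec_transpose, hZ, hW]
      rw [hN, cycleGram_mulVec_triangleVec] at h1
      simp only [dotProduct_smul, smul_dotProduct, smul_eq_mul] at h1
      linear_combination h1
    have hd : (5 : ℤ) ∣ triangleVec c ℤ X ⬝ᵥ triangleVec c ℤ Y := by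
      obtain ⟨m, hm⟩ := h5
      have hp : Prime (5 : ℤ) := by norm_num
      have h' : m * (triangleVec c ℤ X ⬝ᵥ triangleVec c ℤ Y) = 5 * (Z ⬝ᵥ W) := by
        rw [hm] at h
        linarith
      refine (hp.dvd_or_dvd ⟨_, h'⟩).resolve_left fun hmd => h25 ?_
      rw [hm]
      exact mul_dvd_mul_left 5 hmd
    rw [← triangleVec_dotProduct, triangleVec_map, triangleVec_map]
    have := (ZMod.intCast_zmod_eq_zero_iff_dvd _ 5).2 hd
    rw [← this]
    exact (RingHom.map_dotProduct π _ _).symm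

end

/-! ### Incidence matrices of coverings -/

/-- On a 2-cycle `σ p = σ.symm p`, and both terms count: these are the two parallel edges. -/
theorem card_filter_cycle_edge {P V : Type*} [Fintype P] [DecidableEq P] [DecidableEq V]
    (e : P → V) (he : Function.Injective e) (σ : Equiv.Perm P) {p q : P} (hpq : p ≠ q) :
    ((Finset.univ.filter fun r => s(e r, e (σ r)) = s(e p, e q)).card : ℤ) =
      (if q = σ p then 1 else 0) + (if q = σ.symm p then 1 else 0) := by
  have h : (Finset.univ.filter fun r => s(e r, e (σ r)) = s(e p, e q)) =
      (if q = σ p then {p} else ∅) ∪ (if q = σ.symm p then {q} else ∅) := by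
    ext r
    simp only [Finset.mem_filter, Finset.mem_univ, true_and, Sym2.eq_iff, he.eq_iff,
      Finset.mem_union, Equiv.eq_symm_apply]
    split_ifs <;> simp <;> grind
  rw [h, Finset.card_union_of_disjoint]
  · split_ifs <;> simp
  · split_ifs <;> simp [hpq]

theorem cycleSucc_ne_self {τ : Type*} {c : τ → ℕ} (hc : ∀ i, 2 ≤ c i)
    (p : (i : τ) × Fin (c i)) : cycleSucc c p ≠ p := by
  obtain ⟨i, j⟩ := p
  intro h
  exact finRotate_ne_self (hc i) j (eq_of_heq (Sigma.mk.inj h).2)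

namespace PairCovering

variable {V ι : Type*} [DecidableEq V]

/-- The incidence matrix of a family of blocks, with rows indexed through `e`. -/
def incidence {P : Type*} (B : ι → Finset V) (e : P → V) : Matrix P ι ℤ :=
  Matrix.of fun p i => if e p ∈ B i then 1 else 0

variable [Fintype ι]

theorem incidence_mul_transpose {P : Type*} (B : ι → Finset V) (e : P → V) (p q : P) :
    (incidence B e * (incidence B e)ᵀ) p q = pairCount B (e p) (e q) := by
  simp [incidence, Matrix.mul_apply, pairCount, ← ite_and, ← Finset.sum_boole, and_comm]

variable [Fintype V]

theorem sum_pairCount (B : ι → Finset V) {k : ℕ} (hB : ∀ i, (B i).card = k) (x : V) :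
    ∑ y, pairCount B x y = k * pairCount B x x := by
  simp only [pairCount, Finset.card_filter]
  rw [Finset.sum_comm, Finset.mul_sum]
  refine Finset.sum_congr rfl fun i _ => ?_
  by_cases h : x ∈ B i
  · simp [h, hB i]
  · simp [h]

theorem incidence_mul_transpose_eq_cycleGram {t : ℕ} {c : Fin t → ℕ} {B : ι → Finset V} {k : ℕ}
    (hk1 : k ≠ 1) (hB : ∀ i, (B i).card = k) (hcov : ∀ x y, x ≠ y → 1 ≤ pairCount B x y)
    (hV : (Fintype.card V : ℤ) = k * (k - 1) - 1) (hc : ∀ i, 2 ≤ c i)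
    (e : (i : Fin t) × Fin (c i) ≃ V)
    (he : ∀ x y, (excess B 1).mult x y =
      (Finset.univ.filter fun p => s(e p, e (cycleSucc c p)) = s(x, y)).card) :
    incidence B e * (incidence B e)ᵀ = cycleGram c ((k : ℤ) - 1) := by
  have hne (p) : p ≠ cycleSucc c p := (cycleSucc_ne_self hc p).symm
  have hne' (p) : p ≠ (cycleSucc c).symm p := fun h =>
    hne p ((Equiv.eq_symm_apply _).1 h).symm
  -- The diagonal parameter may still depend on `p`; the -1 offsets the diagonal of `J`.
  have hpair (p q) : (pairCount B (e p) (e q) : ℤ) =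
      cycleGram c ((pairCount B (e p) (e p) : ℤ) - 1) p q := by
    simp only [cycleGram, of_apply]
    by_cases hpq : q = p
    · subst hpq
      simp [hne q, hne' q]
    · have h1 := card_filter_cycle_edge e e.injective (cycleSucc c) (Ne.symm hpq)
      have hxy : e p ≠ e q := fun h => hpq (e.injective h).symm
      have h2 := hcov _ _ hxy
      rw [← he] at h1
      simp only [excess, hxy, if_false] at h1
      rw [if_neg hpq, zero_add, ← h1]
      omega
  -- With `r` the number of blocks through the point, the row sum gives `k r = (r - 1) + 2 + v`, so
  -- `(k - 1) r = k (k - 1)`.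
  have hdiag (p) : (pairCount B (e p) (e p) : ℤ) = k := by
    have h1 := sum_pairCount B hB (e p)
    rw [← e.sum_comp] at h1
    have h2 : ∑ q, (pairCount B (e p) (e q) : ℤ) = k * pairCount B (e p) (e p) := by
      exact_mod_cast h1
    have h3 := cycleGram_mulVec (c := c) ((pairCount B (e p) (e p) : ℤ) - 1) 1 p
    simp only [mulVec, dotProduct_one, ← hpair, h2, Pi.one_apply, Finset.sum_const,
      Finset.card_univ, Fintype.card_congr e, nsmul_eq_mul, mul_one, hV] at h3
    have h4 : ((k : ℤ) - 1) * (pairCount B (e p) (e p) - k) = 0 := by linear_combination h3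
    have h5 : (k : ℤ) - 1 ≠ 0 := by omega
    linarith [(mul_eq_zero.1 h4).resolve_left h5]
  ext p q
  rw [incidence_mul_transpose, hpair, hdiag]

end PairCovering

theorem mainTheorem9 (v k : ℕ)
    (hk : k ≡ 7 [MOD 25] ∨ k ≡ 12 [MOD 25] ∨ k ≡ 17 [MOD 25] ∨ k ≡ 22 [MOD 25])
    (hv : (v : ℤ) = (k : ℤ) * ((k : ℤ) - 1) - 1)
    {V ι : Type*} [Fintype V] [DecidableEq V] [Fintype ι] (B : ι → Finset V)
    (hB : PairCovering.IsSymmetricCovering B v k 1) :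
    ¬ ∃ (t : ℕ) (c : Fin t → ℕ), (∀ i, c i = 2 ∨ c i = 3) ∧
      (PairCovering.excess B 1).HasCycleType c := by
  rintro ⟨t, c, hc, hc2, w, hw, hmult⟩
  have hV : (Fintype.card V : ℤ) = k * (k - 1) - 1 := by rw [hB.card_points, hv]
  have hk5 : ∃ m : ℤ, (k : ℤ) - 2 = 5 * m ∧ ¬ (25 : ℤ) ∣ k - 2 := by
    refine ⟨((k : ℤ) - 2) / 5, ?_⟩
    simp only [Nat.ModEq] at hk
    omega
  obtain ⟨m, hm, h25⟩ := hk5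
  have hk1 : k ≠ 1 := by omega
  let e : (i : Fin t) × Fin (c i) ≃ V := Equiv.ofBijective _ hw
  have hN := PairCovering.incidence_mul_transpose_eq_cycleGram hk1 hB.card_block hB.covers hV hc2 e
    hmult
  have hP : Fintype.card ((i : Fin t) × Fin (c i)) = Fintype.card V := Fintype.card_congr e
  have hcard : (Fintype.card ((i : Fin t) × Fin (c i)) : ZMod 5) = 1 := by
    -- `v - 1 = (k - 2) (k + 1)`.
    have h : ((Fintype.card V : ℤ) - 1 : ℤ) = 5 * (m * (k + 1)) := by
      rw [hV]; linear_combination ((k : ℤ) + 1) * hm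
    have h' := (ZMod.intCast_zmod_eq_zero_iff_dvd _ 5).2 (Dvd.intro _ h.symm)
    push_cast at h'
    rw [hP]
    exact sub_eq_zero.1 h'
  have heven := even_card_triangles hc hcard (hB.card_blocks.trans hP.symm) _
    (Dvd.intro m (by rw [← hm]; ring)) (by rwa [sub_sub, one_add_one_eq_two]) _ hN
  have hsum : Fintype.card V = 2 * t + Fintype.card {i // c i = 3} := by
    rw [← hP, Fintype.card_sigma, Fintype.card_subtype, Finset.card_filter]
    have (i : Fin t) : Fintype.card (Fin (c i)) = 2 + if c i = 3 then 1 else 0 := by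
      rcases hc i with h | h <;> simp [h]
    simp only [this, Finset.sum_add_distrib]
    simp [mul_comm]
  have hVeven : Even (Fintype.card V) := by
    rw [hsum]; exact (even_two_mul t).add heven
  have h1 : Even ((k : ℤ) * (k - 1)) := Int.even_mul_pred_self k
  have h2 : Even (Fintype.card V : ℤ) := by exact_mod_cast hVeven
  rw [hV] at h2
  have h3 := h1.sub h2
  rw [sub_sub_cancel] at h3
  exact absurd h3 (by decide)
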